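/- **Theorem.** Let $T^n=(S^1)^n$ be the compact torus, and let the standard torus $T^6$ act on $\mathbb{C}P^5$ by $(s_1,\dots,s_6)\cdot[z_1:\dots:z_6]=[s_1z_1:\dots:s_6z_6]$. Let $T^4$ act on $\mathbb{C}P^5$ through the homomorphism ("second symmetric power") $$T^4\to T^6,\qquad (t_1,t_2,t_3,t_4)\mapsto(t_1t_2,\;t_1t_3,\;t_1t_4,\;t_2t_3,\;t_2t_4,\;t_3t_4).$$ Let $\Delta_{4,2}=\{x\in\mathbb{R}^4 : 0\le x_i\le 1 \text{ for all } i,\ x_1+x_2+x_3+x_4=2\}$ be the hypersimplex (an octahedron), with boundary $\partial\Delta_{4,2}$ taken in the hyperplane $x_1+x_2+x_3+x_4=2$. Then the orbit space $\mathbb{C}P^5/T^4$, with the quotient topology, is homeomorphic to the quotient space $$(\Delta_{4,2}\times\mathbb{C}P^2)/\!\approx,$$ where, for $(x,c)\ne(y,c')$, $(x,c)\approx(y,c')$ if and only if $x=y\in\partial\Delta_{4,2}$. Moreover (corollary), $\mathbb{C}P^5/T^4$ is homeomorphic to the join $S^2*\mathbb{C}P^2$, where $X*Y$ denotes the quotient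 of $X\times Y\times[0,1]$ by the identifications $(x,y,0)\sim(x,y',0)$ and $(x,y,1)\sim(x',y,1)$. -/

import Mathlib

open scoped LinearAlgebra.Projectivization

/-- The projectivization of a topological vector space carries the quotient topology
from the space of nonzero vectors. -/
instance Projectivization.instTopologicalSpaceQuotient (K V : Type*) [DivisionRing K]
    [AddCommGroup V] [Module K V] [TopologicalSpace V] : TopologicalSpace (ℙ K V) :=
  inferInstanceAs (TopologicalSpace (Quotient (projectivizationSetoid K V)))

/-- Complex projective space `ℂPⁿ`. -/
abbrev ComplexProjectiveSpace (n : ℕ) : Type := ℙ ℂ (Fin (n + 1) → ℂ)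

/-- The compact torus `Tⁿ`. -/
abbrev CompactTorus (n : ℕ) : Type := Fin n → Circle

/-- The coordinatewise action of the torus on `ℂⁿ` is `ℂ`-linear. -/
instance CompactTorus.instSMulCommClass (n : ℕ) :
    SMulCommClass (CompactTorus n) ℂ (Fin n → ℂ) where
  smul_comm t c v := by
    funext i
    exact smul_comm (t i) c (v i)

/-- The standard action of `Tⁿ⁺¹` on `ℂPⁿ`,
`t • [z₀ : … : zₙ] = [t₀ z₀ : … : tₙ zₙ]`, see `standardTorusAction_mk`. -/
@[reducible]
noncomputable def standardTorusAction (n : ℕ) :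
    MulAction (CompactTorus (n + 1)) (ComplexProjectiveSpace n) :=
  inferInstance

/-- The standard action in homogeneous coordinates. -/
theorem standardTorusAction_mk (n : ℕ) (t : CompactTorus (n + 1)) (z : Fin (n + 1) → ℂ)
    (hz : z ≠ 0) (hz' : (fun i => (t i : ℂ) * z i) ≠ 0) :
    (standardTorusAction n).smul t (Projectivization.mk ℂ z hz) =
      Projectivization.mk ℂ (fun i => (t i : ℂ) * z i) hz' :=
  rfl

/-- The homomorphism `T⁴ → T⁶`,
`(t₁, t₂, t₃, t₄) ↦ (t₁t₂, t₁t₃, t₁t₄, t₂t₃, t₂t₄, t₃t₄)`. -/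
noncomputable def secondSymmetricPower : CompactTorus 4 →* CompactTorus 6 where
  toFun t := ![t 0 * t 1, t 0 * t 2, t 0 * t 3, t 1 * t 2, t 1 * t 3, t 2 * t 3]
  map_one' := by
    funext i
    fin_cases i <;> simp
  map_mul' s t := by
    funext i
    fin_cases i <;> simp [mul_mul_mul_comm]

/-- The action of `T⁴` on `ℂP⁵` obtained by composing `T⁴ → T⁶` with the standard action
of `T⁶`. -/
@[reducible]
noncomputable def symmetricPowerAction : MulAction (CompactTorus 4) (ComplexProjectiveSpace 5) :=
  letI : MulAction (CompactTorus 6) (ComplexProjectiveSpace 5) := standardTorusAction 5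
  MulAction.compHom (ComplexProjectiveSpace 5) secondSymmetricPower

/-- The equivalence relation on `ℂP⁵` of lying in one `T⁴`-orbit. -/
@[reducible]
noncomputable def symmetricPowerOrbitRel : Setoid (ComplexProjectiveSpace 5) :=
  @MulAction.orbitRel (CompactTorus 4) (ComplexProjectiveSpace 5) _ symmetricPowerAction

/-- The orbit space `ℂP⁵ / T⁴`, with the quotient topology. -/
abbrev SymmetricPowerOrbitSpace : Type := Quotient symmetricPowerOrbitRel

/-- The hypersimplex `Δ_{n,k} ⊆ ℝⁿ`. -/
def hypersimplex (n k : ℕ) : Set (Fin n → ℝ) :=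
  {x | (∀ i, 0 ≤ x i ∧ x i ≤ 1) ∧ ∑ i, x i = k}

/-- On `Δ × Y`, for `Δ` a subset of `ℝⁿ`, identify `(x, c)` and `(y, c')`
when `x = y` lies in the relative boundary of `Δ`
(that is, the boundary of `Δ` within its affine span). -/
@[reducible]
def boundaryGluing {n : ℕ} (Δ : Set (Fin n → ℝ)) (Y : Type*) : Setoid (Δ × Y) where
  r p q := p = q ∨ (p.1 = q.1 ∧ (p.1 : Fin n → ℝ) ∈ intrinsicFrontier ℝ Δ)
  iseqv :=
    { refl := fun _ => Or.inl rfl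
      symm := by
        rintro p q (h | ⟨h, hb⟩)
        · exact Or.inl h.symm
        · exact Or.inr ⟨h.symm, h ▸ hb⟩
      trans := by
        rintro p q r (rfl | ⟨h, hb⟩) h'
        · exact h'
        · rcases h' with rfl | ⟨h', _⟩
          · exact Or.inr ⟨h, hb⟩
          · exact Or.inr ⟨h.trans h', hb⟩ }

/-- The relation on `X × Y × [0, 1]` that collapses `Y` at `0` and `X` at `1`. -/
@[reducible]
def joinSetoid (X Y : Type*) : Setoid (X × Y × unitInterval) where
  r p q := p = q ∨ (p.2.2 = 0 ∧ q.2.2 = 0 ∧ p.1 = q.1) ∨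
    (p.2.2 = 1 ∧ q.2.2 = 1 ∧ p.2.1 = q.2.1)
  iseqv :=
    { refl := fun _ => Or.inl rfl
      symm := by
        rintro p q (h | ⟨h0, h1, h⟩ | ⟨h0, h1, h⟩)
        · exact Or.inl h.symm
        · exact Or.inr (Or.inl ⟨h1, h0, h.symm⟩)
        · exact Or.inr (Or.inr ⟨h1, h0, h.symm⟩)
      trans := by
        rintro p q r (rfl | ⟨h0, h1, h⟩ | ⟨h0, h1, h⟩) h'
        · exact h'
        · rcases h' with rfl | ⟨k0, k1, k⟩ | ⟨k0, k1, k⟩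
          · exact Or.inr (Or.inl ⟨h0, h1, h⟩)
          · exact Or.inr (Or.inl ⟨h0, k1, h.trans k⟩)
          · exact absurd (h1.symm.trans k0) zero_ne_one
        · rcases h' with rfl | ⟨k0, k1, k⟩ | ⟨k0, k1, k⟩
          · exact Or.inr (Or.inr ⟨h0, h1, h⟩)
          · exact absurd (k0.symm.trans h1) zero_ne_one
          · exact Or.inr (Or.inr ⟨h0, k1, h.trans k⟩) }

/-- The topological join `X ∗ Y` of two nonempty spaces, with the quotient topology. -/
abbrev TopologicalJoin (X Y : Type*) : Type _ := Quotient (joinSetoid X Y)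

open Topology

/-! The six coordinates of a unit vector `z` form three opposite pairs `(p_i, q_i)`, and the
products `w_i = p_i q_i` all have weight `t₁t₂t₃t₄`. The image of `T⁴` in `T⁶` is exactly the
subgroup where opposite entries have a common product, so orbits in `ℂP⁵` are separated by the norms
of the coordinates together with `w` up to a common phase. The moment map `d_i = |p_i|² - |q_i|²`
has the octahedron `∑ |d_i| ≤ 1` as image, and `|p_i|² + |q_i|² = √(d_i² + 4|w_i|²)`. These sums add
up to 1, so `d` and the line `[w]` determine the size of `w`, hence the orbit; `w = 0` occurs
exactly on the boundary.

Since `[w]` is undefined where `w = 0`, the comparison uses the compact set `momentCorrespondence`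
of compatible triples `(z, x, v)`. Both of its projections are quotient maps, and
`momentCorrespondence_fibres` shows that the two composites to the final quotients have the same
fibres. For the join, the octahedron is the cone over its boundary sphere. -/

/-- Two quotient maps on the same space with the same fibres have homeomorphic targets. -/
theorem Topology.IsQuotientMap.nonempty_homeomorph {X Y Z : Type*} [TopologicalSpace X]
    [TopologicalSpace Y] [TopologicalSpace Z] {f : X → Y} {g : X → Z}
    (hf : IsQuotientMap f) (hg : IsQuotientMap g) (h : ∀ a b, f a = f b ↔ g a = g b) :
    Nonempty (Y ≃ₜ Z) := by
  have hk : Setoid.ker f = Setoid.ker g := Setoid.ext fun a b => h a b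
  have e := IsQuotientMap.homeomorph (f := ⟨g, hg.continuous⟩) hg
  rw [ContinuousMap.coe_mk, ← hk] at e
  exact ⟨(IsQuotientMap.homeomorph (f := ⟨f, hf.continuous⟩) hf).symm.trans e⟩

/-! ### Projective space as a quotient of nonzero vectors and of the unit sphere -/

namespace Projectivization

variable {K V : Type*} [DivisionRing K] [AddCommGroup V] [Module K V] [TopologicalSpace V]

theorem isQuotientMap_mk' : IsQuotientMap (mk' K : {v : V // v ≠ 0} → ℙ K V) :=
  isQuotientMap_quot_mk

/-- The saturation of an open set is the union of its preimages under scaling by units. Openness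
matters because open quotient maps, unlike general ones, are stable under products. -/
theorem isOpenQuotientMap_mk' [ContinuousConstSMul K V] :
    IsOpenQuotientMap (mk' K : {v : V // v ≠ 0} → ℙ K V) := by
  refine ⟨isQuotientMap_mk'.surjective, isQuotientMap_mk'.continuous, fun U hU => ?_⟩
  rw [← isQuotientMap_mk'.isOpen_preimage]
  have : mk' K ⁻¹' (mk' K '' U) = ⋃ u : Kˣ, (fun v : {v : V // v ≠ 0} =>
      (⟨u • v.1, (smul_ne_zero_iff_ne u).2 v.2⟩ : {v : V // v ≠ 0})) ⁻¹' U := by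
    ext v
    simp only [Set.mem_preimage, Set.mem_image, Set.mem_iUnion]
    constructor
    · rintro ⟨w, hw, h⟩
      obtain ⟨u, hu⟩ := (mk_eq_mk_iff K w.1 v.1 w.2 v.2).1 h
      refine ⟨u, ?_⟩
      convert hw
    · rintro ⟨u, hu⟩
      exact ⟨_, hu, (mk_eq_mk_iff K _ _ _ _).2 ⟨u, rfl⟩⟩
  rw [this]
  refine isOpen_iUnion fun u => hU.preimage ?_
  exact (continuous_subtype_val.const_smul u).subtype_mk _

end Projectivization

/-- The unit sphere of `ℂⁿ⁺¹` in its Euclidean norm. -/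
abbrev ComplexUnitSphere (n : ℕ) : Type := {z : Fin (n + 1) → ℂ // ∑ i, ‖z i‖ ^ 2 = 1}

namespace ComplexUnitSphere

variable {n : ℕ}

instance : CompactSpace (ComplexUnitSphere n) := by
  refine isCompact_iff_compactSpace.1 (Metric.isCompact_of_isClosed_isBounded
    (s := {z : Fin (n + 1) → ℂ | ∑ i, ‖z i‖ ^ 2 = 1}) ?_ ?_)
  · exact isClosed_eq (by fun_prop) continuous_const
  · refine (Metric.isBounded_closedBall (x := (0 : Fin (n + 1) → ℂ)) (r := 1)).subset fun z hz => ?_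
    rw [mem_closedBall_zero_iff, pi_norm_le_iff_of_nonneg zero_le_one]
    intro i
    have h : ‖z i‖ ^ 2 ≤ ∑ j, ‖z j‖ ^ 2 :=
      Finset.single_le_sum (f := fun j => ‖z j‖ ^ 2) (fun j _ => by positivity) (Finset.mem_univ i)
    rw [hz.out] at h
    nlinarith [norm_nonneg (z i)]

theorem ne_zero (z : ComplexUnitSphere n) : z.1 ≠ 0 := by
  intro h
  have := z.2
  simp [h] at this

theorem sum_norm_sq_pos {z : Fin (n + 1) → ℂ} (hz : z ≠ 0) : 0 < ∑ i, ‖z i‖ ^ 2 := by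
  obtain ⟨i, hi⟩ := Function.ne_iff.1 hz
  have hi' : 0 < ‖z i‖ := norm_pos_iff.2 hi
  exact Finset.sum_pos' (fun j _ => by positivity) ⟨i, Finset.mem_univ i, by positivity⟩

/-- The point of projective space spanned by a unit vector. -/
noncomputable def toProj (z : ComplexUnitSphere n) : ComplexProjectiveSpace n :=
  Projectivization.mk ℂ z.1 z.ne_zero

/-- Normalization of a nonzero vector. -/
noncomputable def normalize (z : {v : Fin (n + 1) → ℂ // v ≠ 0}) : ComplexUnitSphere n :=
  ⟨((√(∑ i, ‖z.1 i‖ ^ 2))⁻¹ : ℝ) • z.1, by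
    have h := sum_norm_sq_pos z.2
    simp only [Pi.smul_apply, norm_smul, mul_pow, norm_inv, inv_pow, Real.norm_eq_abs, sq_abs,
      Real.sq_sqrt h.le, ← Finset.mul_sum]
    exact inv_mul_cancel₀ h.ne'⟩

theorem continuous_normalize : Continuous (normalize (n := n)) := by
  refine Continuous.subtype_mk (Continuous.smul (Continuous.inv₀ (Real.continuous_sqrt.comp
    (continuous_finsetSum _ fun i _ =>
      ((continuous_apply i).comp continuous_subtype_val).norm.pow 2)) fun z => ?_)
    continuous_subtype_val) _
  exact (Real.sqrt_pos.2 (sum_norm_sq_pos z.2)).ne'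

theorem toProj_normalize (z : {v : Fin (n + 1) → ℂ // v ≠ 0}) :
    (normalize z).toProj = Projectivization.mk' ℂ z := by
  refine (Projectivization.mk_eq_mk_iff' ℂ _ _ _ _).2
    ⟨((√(∑ i, ‖z.1 i‖ ^ 2))⁻¹ : ℝ), ?_⟩
  exact Complex.coe_smul _ _

theorem continuous_toProj : Continuous (toProj (n := n)) :=
  Projectivization.isQuotientMap_mk'.continuous.comp
    (continuous_subtype_val.subtype_mk ne_zero)

theorem isQuotientMap_prodMap_toProj (X : Type*) [TopologicalSpace X] :
    IsQuotientMap (Prod.map (id : X → X) (toProj (n := n))) := by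
  refine IsQuotientMap.of_comp (f := Prod.map (id : X → X) (normalize (n := n)))
    (continuous_id.prodMap continuous_normalize) (continuous_id.prodMap continuous_toProj) ?_
  have h := (IsOpenQuotientMap.id (X := X)).prodMap
    (Projectivization.isOpenQuotientMap_mk' (K := ℂ) (V := Fin (n + 1) → ℂ))
  convert h.isQuotientMap using 1
  funext p
  exact Prod.ext rfl (toProj_normalize p.2)

theorem isQuotientMap_toProj : IsQuotientMap (toProj (n := n)) :=
  IsQuotientMap.of_comp continuous_normalize continuous_toProj
    (by convert Projectivization.isQuotientMap_mk' (K := ℂ) (V := Fin (n + 1) → ℂ) using 1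
        funext z
        exact toProj_normalize z)

theorem toProj_eq_iff {v w : ComplexUnitSphere n} :
    v.toProj = w.toProj ↔ ∃ c : ℂ, ∀ i, v.1 i = c * w.1 i := by
  refine (Projectivization.mk_eq_mk_iff' ℂ _ _ _ _).trans (exists_congr fun c => ?_)
  simp [funext_iff, eq_comm]

end ComplexUnitSphere

/-! ### Adjusting phases of complex numbers -/

theorem exists_circle_mul_eq {p q : ℂ} (h : ‖p‖ = ‖q‖) : ∃ s : Circle, q = s * p := by
  by_cases hp : p = 0
  · subst hp
    exact ⟨1, by simpa using h.symm⟩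
  · refine ⟨⟨q / p, ?_⟩, (div_mul_cancel₀ q hp).symm⟩
    refine mem_sphere_zero_iff_norm.2 ?_
    rw [norm_div, h, div_self]
    rwa [← h, norm_ne_zero_iff]

theorem Circle.exists_sq_eq (x : Circle) : ∃ t : Circle, t * t = x :=
  ⟨Circle.exp (Complex.arg x / 2), by rw [← Circle.exp_add, add_halves, Circle.exp_arg]⟩

/-- If `q ≠ 0`, its phase is chosen first and the product relation yields the phase of `p`. If `q =
0`, the phase of `q` is free and absorbs `c`. -/
theorem exists_circle_pair {p q p' q' : ℂ} {c : Circle} (hp : ‖p‖ = ‖p'‖) (hq : ‖q‖ = ‖q'‖)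
    (h : p' * q' = c * (p * q)) :
    ∃ s s' : Circle, s * s' = c ∧ p' = s * p ∧ q' = s' * q := by
  by_cases hq0 : q = 0
  · subst hq0
    obtain ⟨s, hs⟩ := exists_circle_mul_eq hp
    exact ⟨s, s⁻¹ * c, by simp, hs, by simpa using hq.symm⟩
  · obtain ⟨s, hs⟩ := exists_circle_mul_eq hq
    refine ⟨c * s⁻¹, s, by simp, ?_, hs⟩
    rw [hs] at h
    have h' : p' * s = c * p := mul_right_cancel₀ hq0 (by linear_combination h)
    have hs0 : (s : ℂ) ≠ 0 := s.coe_ne_zero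
    rw [Circle.coe_mul, Circle.coe_inv]
    field_simp
    exact h'

/-! ### The octahedron and its relative boundary -/

/-- Coordinates on the hyperplane of sum two in which the octahedron `Δ_{4,2}` is the unit ball of
the `ℓ¹` norm. -/
def octahedralCoord (x : Fin 4 → ℝ) (i : Fin 3) : ℝ := x 0 + x i.succ - 1

/-- The point of the hyperplane of sum two with given octahedral coordinates. -/
noncomputable def ofOctahedralCoord (d : Fin 3 → ℝ) : Fin 4 → ℝ :=
  ![(1 + d 0 + d 1 + d 2) / 2, (1 + d 0 - d 1 - d 2) / 2, (1 - d 0 + d 1 - d 2) / 2,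
    (1 - d 0 - d 1 + d 2) / 2]

theorem octahedralCoord_ofOctahedralCoord (d : Fin 3 → ℝ) :
    octahedralCoord (ofOctahedralCoord d) = d := by
  funext i
  fin_cases i <;> simp [octahedralCoord, ofOctahedralCoord] <;> ring

theorem sum_ofOctahedralCoord (d : Fin 3 → ℝ) : ∑ i, ofOctahedralCoord d i = 2 := by
  simp [Fin.sum_univ_four, ofOctahedralCoord]
  ring

theorem ofOctahedralCoord_octahedralCoord {x : Fin 4 → ℝ} (hx : ∑ i, x i = 2) :
    ofOctahedralCoord (octahedralCoord x) = x := by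
  rw [Fin.sum_univ_four] at hx
  funext i
  fin_cases i <;> simp [octahedralCoord, ofOctahedralCoord, Fin.succ] <;> linarith

theorem continuous_octahedralCoord : Continuous octahedralCoord := by
  unfold octahedralCoord
  fun_prop

theorem continuous_ofOctahedralCoord : Continuous ofOctahedralCoord := by
  refine continuous_pi fun i => ?_
  fin_cases i <;> simp [ofOctahedralCoord] <;> fun_prop

/-- The eight inequalities `0 ≤ x i ≤ 1` become the eight inequalities `±d₀ ± d₁ ± d₂ ≤ 1`, one for
each face. -/
theorem mem_hypersimplex_four_two_iff {x : Fin 4 → ℝ} :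
    x ∈ hypersimplex 4 2 ↔ ∑ i, x i = 2 ∧ ∑ i, |octahedralCoord x i| ≤ 1 := by
  simp only [hypersimplex, Set.mem_ofPred_eq, Nat.cast_ofNat, and_comm (b := ∑ i, x i = 2)]
  refine and_congr_right fun hx => ?_
  rw [Fin.sum_univ_four] at hx
  simp only [Fin.sum_univ_three, octahedralCoord, Fin.forall_fin_succ, Fin.succ_zero_eq_one,
    Fin.succ_one_eq_two, IsEmpty.forall_iff, and_true, Fin.reduceSucc]
  constructor
  · rintro ⟨⟨_, _⟩, ⟨_, _⟩, ⟨_, _⟩, _, _⟩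
    rcases abs_cases (x 0 + x 1 - 1) with ⟨h1, _⟩ | ⟨h1, _⟩ <;>
    rcases abs_cases (x 0 + x 2 - 1) with ⟨h2, _⟩ | ⟨h2, _⟩ <;>
    rcases abs_cases (x 0 + x 3 - 1) with ⟨h3, _⟩ | ⟨h3, _⟩ <;>
    rw [h1, h2, h3] <;> linarith
  · intro h
    have h1 := le_abs_self (x 0 + x 1 - 1)
    have h1' := neg_le_abs (x 0 + x 1 - 1)
    have h2 := le_abs_self (x 0 + x 2 - 1)
    have h2' := neg_le_abs (x 0 + x 2 - 1)
    have h3 := le_abs_self (x 0 + x 3 - 1)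
    have h3' := neg_le_abs (x 0 + x 3 - 1)
    refine ⟨⟨?_, ?_⟩, ⟨?_, ?_⟩, ⟨?_, ?_⟩, ?_, ?_⟩ <;> linarith

theorem ofOctahedralCoord_mem {d : Fin 3 → ℝ} (hd : ∑ i, |d i| ≤ 1) :
    ofOctahedralCoord d ∈ hypersimplex 4 2 :=
  mem_hypersimplex_four_two_iff.2
    ⟨sum_ofOctahedralCoord d, by rwa [octahedralCoord_ofOctahedralCoord]⟩

theorem octahedralCoord_injOn : Set.InjOn octahedralCoord (hypersimplex 4 2) := fun x hx y hy h => by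
  rw [← ofOctahedralCoord_octahedralCoord (mem_hypersimplex_four_two_iff.1 hx).1, h,
    ofOctahedralCoord_octahedralCoord (mem_hypersimplex_four_two_iff.1 hy).1]

theorem isClosed_hypersimplex_four_two : IsClosed (hypersimplex 4 2) := by
  have : hypersimplex 4 2 =
      {x | ∑ i, x i = 2} ∩ {x | ∑ i, |octahedralCoord x i| ≤ 1} := by
    ext x
    exact mem_hypersimplex_four_two_iff
  rw [this]
  refine (isClosed_eq (by fun_prop) continuous_const).inter
    (isClosed_le (continuous_finsetSum _ fun i _ => ?_) continuous_const)
  exact ((continuous_apply i).comp continuous_octahedralCoord).abs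

instance : CompactSpace (hypersimplex 4 2) := by
  refine isCompact_iff_compactSpace.1 (Metric.isCompact_of_isClosed_isBounded
    isClosed_hypersimplex_four_two ?_)
  refine (Metric.isBounded_closedBall (x := (0 : Fin 4 → ℝ)) (r := 1)).subset fun x hx => ?_
  rw [mem_closedBall_zero_iff, pi_norm_le_iff_of_nonneg zero_le_one]
  intro i
  rw [Real.norm_of_nonneg (hx.1 i).1]
  exact (hx.1 i).2

theorem sum_eq_of_mem_affineSpan_hypersimplex {n k : ℕ} {x : Fin n → ℝ}
    (hx : x ∈ affineSpan ℝ (hypersimplex n k)) : ∑ i, x i = k := by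
  refine affineSpan_induction (p := fun x : Fin n → ℝ => ∑ i, x i = k) hx (fun y hy => hy.2) ?_
  intro c u v w hu hv hw
  simp [Finset.sum_add_distrib, ← Finset.mul_sum, hu, hv, hw]

theorem mem_intrinsicInterior_hypersimplex_iff {x : Fin 4 → ℝ} (hx : x ∈ hypersimplex 4 2) :
    x ∈ intrinsicInterior ℝ (hypersimplex 4 2) ↔ ∑ i, |octahedralCoord x i| < 1 := by
  set s := hypersimplex 4 2
  have hcont : Continuous fun y : Fin 4 → ℝ => ∑ i, |octahedralCoord y i| :=
    continuous_finsetSum _ fun i _ => ((continuous_apply i).comp continuous_octahedralCoord).abs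
  rw [mem_intrinsicInterior]
  constructor
  · rintro ⟨y, hy, rfl⟩
    refine lt_of_le_of_ne (mem_hypersimplex_four_two_iff.1 hx).2 fun h1 => ?_
    have hc : ofOctahedralCoord 0 ∈ s := ofOctahedralCoord_mem (by simp)
    -- The ray from the centre through `y`, continued past `y`: octahedral coordinates vanish at the
    -- centre, so they are dilated by `t` and the `ℓ¹` norm exceeds 1 just after `t = 1`.
    let f : ℝ → affineSpan ℝ s := fun t =>
      ⟨AffineMap.lineMap (ofOctahedralCoord 0) (y : Fin 4 → ℝ) t,
        AffineMap.lineMap_mem _ (mem_affineSpan ℝ hc) y.2⟩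
    have hf : Continuous f := AffineMap.lineMap_continuous.subtype_mk _
    have hf1 : f 1 = y := Subtype.ext (AffineMap.lineMap_apply_one _ _)
    have hnhds : f ⁻¹' ((↑) ⁻¹' s) ∈ 𝓝 (1 : ℝ) :=
      hf.continuousAt.preimage_mem_nhds (by rw [hf1]; exact mem_interior_iff_mem_nhds.1 hy)
    obtain ⟨ε, hε, hball⟩ := Metric.mem_nhds_iff.1 hnhds
    have hmem : (1 + ε / 2) ∈ Metric.ball (1 : ℝ) ε := by
      rw [Metric.mem_ball, Real.dist_eq, add_sub_cancel_left, abs_of_pos (half_pos hε)]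
      exact half_lt_self hε
    have h2 := (mem_hypersimplex_four_two_iff.1 (hball hmem)).2
    have h3 : ∀ i, octahedralCoord (f (1 + ε / 2) : Fin 4 → ℝ) i =
        (1 + ε / 2) * octahedralCoord y i := by
      intro i
      have h0 : ∀ k, ofOctahedralCoord 0 k = 1 / 2 := by
        intro k
        fin_cases k <;> simp [ofOctahedralCoord]
      simp only [f, octahedralCoord, AffineMap.lineMap_apply, vsub_eq_sub, vadd_eq_add,
        Pi.add_apply, Pi.smul_apply, Pi.sub_apply, smul_eq_mul, h0]
      ring
    simp only [h3, abs_mul, ← Finset.mul_sum, h1, mul_one] at h2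
    rw [abs_of_pos (by positivity)] at h2
    linarith
  · intro h
    refine ⟨⟨x, mem_affineSpan ℝ hx⟩, ?_, rfl⟩
    refine mem_interior.2
      ⟨Subtype.val ⁻¹' {y : Fin 4 → ℝ | ∑ i, |octahedralCoord y i| < 1}, ?_, ?_, h⟩
    · intro y hy
      refine mem_hypersimplex_four_two_iff.2 ⟨?_, le_of_lt hy⟩
      simpa using sum_eq_of_mem_affineSpan_hypersimplex y.2
    · exact (isOpen_lt hcont continuous_const).preimage continuous_subtype_val

theorem mem_intrinsicFrontier_hypersimplex_iff {x : Fin 4 → ℝ} (hx : x ∈ hypersimplex 4 2) :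
    x ∈ intrinsicFrontier ℝ (hypersimplex 4 2) ↔ ∑ i, |octahedralCoord x i| = 1 := by
  rw [← intrinsicClosure_sdiff_intrinsicInterior, Set.mem_sdiff,
    mem_intrinsicInterior_hypersimplex_iff hx, not_lt]
  exact ⟨fun h => le_antisymm (mem_hypersimplex_four_two_iff.1 hx).2 h.2,
    fun h => ⟨subset_intrinsicClosure hx, h.ge⟩⟩

/-! ### The torus invariants: moment map and opposite products -/

/-- One vertex of each of the three diagonals of the octahedron; the six vertices index the
homogeneous coordinates of `ℂP⁵`. -/
def vertex : Fin 3 → Fin 6 := ![0, 1, 2]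

/-- The vertex opposite to `vertex i`. -/
def antipode : Fin 3 → Fin 6 := ![5, 4, 3]

theorem eq_vertex_or_eq_antipode (k : Fin 6) : ∃ i, k = vertex i ∨ k = antipode i := by
  revert k
  decide

theorem sum_eq_sum_vertex_add_antipode {M : Type*} [AddCommMonoid M] (f : Fin 6 → M) :
    ∑ k, f k = ∑ i, (f (vertex i) + f (antipode i)) := by
  simp only [Fin.sum_univ_six, Fin.sum_univ_three, vertex, antipode, Matrix.cons_val]
  abel

theorem exists_vertex_antipode {α : Type*} (f g : Fin 3 → α) :
    ∃ h : Fin 6 → α, ∀ i, h (vertex i) = f i ∧ h (antipode i) = g i := by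
  refine ⟨![f 0, f 1, f 2, g 2, g 1, g 0], fun i => ?_⟩
  fin_cases i <;> exact ⟨rfl, rfl⟩

/-- The moment map in octahedral coordinates. -/
noncomputable def moment (z : Fin 6 → ℂ) (i : Fin 3) : ℝ :=
  ‖z (vertex i)‖ ^ 2 - ‖z (antipode i)‖ ^ 2

/-- The products of opposite coordinates, which all have the same weight under `T⁴`. -/
def oppositeProduct (z : Fin 6 → ℂ) (i : Fin 3) : ℂ := z (vertex i) * z (antipode i)

theorem continuous_moment : Continuous moment := by
  unfold moment
  fun_prop

theorem continuous_oppositeProduct : Continuous oppositeProduct := by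
  unfold oppositeProduct
  fun_prop

/-- The image of `T⁴` in `T⁶` is cut out by equality of the opposite products. -/
theorem exists_secondSymmetricPower_eq {s : CompactTorus 6} {c : Circle}
    (h : ∀ i, s (vertex i) * s (antipode i) = c) : ∃ t, secondSymmetricPower t = s := by
  have h0 : s 0 * s 5 = c := h 0
  have h1 : s 1 * s 4 = c := h 1
  have h2 : s 2 * s 3 = c := h 2
  -- Forced by `t₁² = (t₁t₂)(t₁t₃)/(t₂t₃)`; either square root will do.
  obtain ⟨t, ht⟩ := Circle.exists_sq_eq (s 0 * s 1 / s 3)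
  refine ⟨![t, s 0 / t, s 1 / t, s 2 / t], ?_⟩
  have e1 : s 0 / t * (s 1 / t) = s 3 := by
    rw [div_mul_div_comm, ht]; exact div_div_cancel _ _
  have e2 : s 0 / t * (s 2 / t) = s 4 := by
    rw [div_mul_div_comm, ht, div_eq_iff_eq_mul, eq_comm, mul_div_assoc', div_eq_iff_eq_mul]
    calc s 4 * (s 0 * s 1) = s 0 * (s 1 * s 4) := by ac_rfl
      _ = s 0 * s 2 * s 3 := by rw [h1, ← h2, mul_assoc]
  have e3 : s 1 / t * (s 2 / t) = s 5 := by
    rw [div_mul_div_comm, ht, div_eq_iff_eq_mul, eq_comm, mul_div_assoc', div_eq_iff_eq_mul]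
    calc s 5 * (s 0 * s 1) = s 1 * (s 0 * s 5) := by ac_rfl
      _ = s 1 * s 2 * s 3 := by rw [h0, ← h2, mul_assoc]
  funext k
  fin_cases k
  · exact mul_div_cancel _ _
  · exact mul_div_cancel _ _
  · exact mul_div_cancel _ _
  · exact e1
  · exact e2
  · exact e3

theorem secondSymmetricPower_vertex_mul_antipode (t : CompactTorus 4) (i : Fin 3) :
    secondSymmetricPower t (vertex i) * secondSymmetricPower t (antipode i) =
      t 0 * t 1 * (t 2 * t 3) := by
  fin_cases i
  · rfl
  · exact mul_mul_mul_comm _ _ _ _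
  · change t 0 * t 3 * (t 1 * t 2) = _
    rw [mul_comm (t 2), ← mul_mul_mul_comm]

theorem exists_torus_of_oppositeProduct_eq {z z' : Fin 6 → ℂ} {c : Circle}
    (hnorm : ∀ k, ‖z k‖ = ‖z' k‖)
    (h : ∀ i, oppositeProduct z' i = c * oppositeProduct z i) :
    ∃ t, ∀ k, z' k = secondSymmetricPower t k * z k := by
  choose s s' hss hs hs' using fun i =>
    exists_circle_pair (hnorm (vertex i)) (hnorm (antipode i)) (h i)
  obtain ⟨r, hr⟩ := exists_vertex_antipode s s'
  obtain ⟨t, ht⟩ := exists_secondSymmetricPower_eq (s := r) (c := c)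
    fun i => by rw [(hr i).1, (hr i).2, hss]
  refine ⟨t, fun k => ?_⟩
  rw [ht]
  obtain ⟨i, rfl | rfl⟩ := eq_vertex_or_eq_antipode k
  · rw [(hr i).1, hs]
  · rw [(hr i).2, hs']

/-- This is `(a + b)² = (a - b)² + 4ab` for the two squared norms. It lets the moment and the size
of the product recover both norms. -/
theorem sq_add_eq_moment_sq_add (z : Fin 6 → ℂ) (i : Fin 3) :
    (‖z (vertex i)‖ ^ 2 + ‖z (antipode i)‖ ^ 2) ^ 2 =
      moment z i ^ 2 + 4 * ‖oppositeProduct z i‖ ^ 2 := by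
  rw [moment, oppositeProduct, norm_mul]
  ring

theorem abs_moment_le (z : Fin 6 → ℂ) (i : Fin 3) :
    |moment z i| ≤ ‖z (vertex i)‖ ^ 2 + ‖z (antipode i)‖ ^ 2 := by
  refine abs_le_of_sq_le_sq ?_ (by positivity)
  rw [sq_add_eq_moment_sq_add]
  exact le_add_of_nonneg_right (by positivity)

theorem abs_moment_eq_iff (z : Fin 6 → ℂ) (i : Fin 3) :
    |moment z i| = ‖z (vertex i)‖ ^ 2 + ‖z (antipode i)‖ ^ 2 ↔ oppositeProduct z i = 0 := by
  rw [← sq_eq_sq₀ (abs_nonneg _) (by positivity), sq_abs, sq_add_eq_moment_sq_add]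
  simp

theorem sum_norm_sq_vertex_add_antipode (z : ComplexUnitSphere 5) :
    ∑ i, (‖z.1 (vertex i)‖ ^ 2 + ‖z.1 (antipode i)‖ ^ 2) = 1 := by
  rw [← sum_eq_sum_vertex_add_antipode fun k => ‖z.1 k‖ ^ 2]
  exact z.2

theorem sum_abs_moment_le_one (z : ComplexUnitSphere 5) : ∑ i, |moment z.1 i| ≤ 1 :=
  (Finset.sum_le_sum fun i _ => abs_moment_le _ i).trans_eq (sum_norm_sq_vertex_add_antipode z)

theorem sum_abs_moment_eq_one_iff (z : ComplexUnitSphere 5) :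
    ∑ i, |moment z.1 i| = 1 ↔ oppositeProduct z.1 = 0 := by
  refine (Eq.congr_right (sum_norm_sq_vertex_add_antipode z).symm).trans ?_
  rw [Finset.sum_eq_sum_iff_of_le fun i _ => abs_moment_le _ i]
  simp [abs_moment_eq_iff, funext_iff]

/-- Larger products with equal moments give larger pair sums, termwise. Both families of pair sums
total 1, so they agree, and sum and difference determine each norm. -/
theorem norm_eq_of_moment_eq_of_norm_le {z z' : ComplexUnitSphere 5}
    (hm : moment z.1 = moment z'.1)
    (hw : ∀ i, ‖oppositeProduct z.1 i‖ ≤ ‖oppositeProduct z'.1 i‖) (k : Fin 6) :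
    ‖z.1 k‖ = ‖z'.1 k‖ := by
  have hle : ∀ i ∈ Finset.univ, ‖z.1 (vertex i)‖ ^ 2 + ‖z.1 (antipode i)‖ ^ 2 ≤
      ‖z'.1 (vertex i)‖ ^ 2 + ‖z'.1 (antipode i)‖ ^ 2 := by
    intro i _
    refine le_of_sq_le_sq ?_ (by positivity)
    rw [sq_add_eq_moment_sq_add, sq_add_eq_moment_sq_add, hm]
    gcongr
    exact hw i
  have heq := (Finset.sum_eq_sum_iff_of_le hle).1
    ((sum_norm_sq_vertex_add_antipode z).trans (sum_norm_sq_vertex_add_antipode z').symm)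
  obtain ⟨i, hk⟩ := eq_vertex_or_eq_antipode k
  have h1 := heq i (Finset.mem_univ i)
  have h2 := congrFun hm i
  simp only [moment] at h2
  rw [← sq_eq_sq₀ (norm_nonneg _) (norm_nonneg _)]
  rcases hk with rfl | rfl <;> linarith

/-- Product vectors on one line are comparable in size, so the norm comparison applies in one
direction or the other. It forces `‖r‖ = ‖r'‖`, leaving only a common phase. The values `r = 0` and
`r' = 0` are allowed, which covers boundary points too. -/
theorem exists_torus_of_moment_eq {z z' : ComplexUnitSphere 5} {v : Fin 3 → ℂ} (hv : v ≠ 0)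
    {r r' : ℂ} (hm : moment z.1 = moment z'.1) (hr : ∀ i, oppositeProduct z.1 i = r * v i)
    (hr' : ∀ i, oppositeProduct z'.1 i = r' * v i) :
    ∃ t, ∀ k, z'.1 k = secondSymmetricPower t k * z.1 k := by
  have hnorm : ∀ k, ‖z.1 k‖ = ‖z'.1 k‖ := by
    rcases le_total ‖r‖ ‖r'‖ with h | h
    · refine norm_eq_of_moment_eq_of_norm_le hm fun i => ?_
      rw [hr, hr', norm_mul, norm_mul]
      gcongr
    · refine fun k => (norm_eq_of_moment_eq_of_norm_le hm.symm (fun i => ?_) k).symm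
      rw [hr, hr', norm_mul, norm_mul]
      gcongr
  obtain ⟨i, hi⟩ := Function.ne_iff.1 hv
  have hrr : ‖r‖ = ‖r'‖ := by
    have h : ‖oppositeProduct z.1 i‖ = ‖oppositeProduct z'.1 i‖ := by
      simp only [oppositeProduct, norm_mul, hnorm]
    rw [hr, hr', norm_mul, norm_mul] at h
    exact mul_right_cancel₀ (norm_ne_zero_iff.2 hi) h
  obtain ⟨c, hc⟩ := exists_circle_mul_eq hrr
  refine exists_torus_of_oppositeProduct_eq (c := c) hnorm fun i => ?_
  rw [hr, hr', hc, mul_assoc]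

/-! ### Realizing a prescribed moment and line of products -/

theorem exists_sum_sqrt_eq_one {d : Fin 3 → ℝ} (hd : ∑ i, |d i| ≤ 1) (v : ComplexUnitSphere 2) :
    ∃ r : ℝ, 0 ≤ r ∧ ∑ i, √(d i ^ 2 + 4 * (r * ‖v.1 i‖) ^ 2) = 1 := by
  have hle : ∀ i, ‖v.1 i‖ ≤ 1 := fun i => by
    have h : ‖v.1 i‖ ^ 2 ≤ ∑ j, ‖v.1 j‖ ^ 2 :=
      Finset.single_le_sum (f := fun j => ‖v.1 j‖ ^ 2) (fun j _ => by positivity)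
        (Finset.mem_univ i)
    rw [v.2] at h
    nlinarith [norm_nonneg (v.1 i)]
  have hcont : ContinuousOn (fun r : ℝ => ∑ i, √(d i ^ 2 + 4 * (r * ‖v.1 i‖) ^ 2))
      (Set.Icc 0 (1 / 2)) := by fun_prop
  -- At `r = 1/2` each term is `√(d i² + ‖v i‖²) ≥ ‖v i‖ ≥ ‖v i‖²`, and these squares sum to 1. At
  -- `r = 0` the sum is `∑ |d i| ≤ 1`, so the intermediate value theorem applies.
  have hone : 1 ≤ ∑ i, √(d i ^ 2 + 4 * (1 / 2 * ‖v.1 i‖) ^ 2) := by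
    refine v.2.symm.trans_le (Finset.sum_le_sum fun i _ => Real.le_sqrt_of_sq_le ?_)
    have h1 : ‖v.1 i‖ ^ 2 ≤ ‖v.1 i‖ := pow_le_of_le_one (norm_nonneg _) (hle i) two_ne_zero
    have h2 : (‖v.1 i‖ ^ 2) ^ 2 ≤ ‖v.1 i‖ ^ 2 := by gcongr
    nlinarith [sq_nonneg (d i)]
  obtain ⟨r, hr, h⟩ := intermediate_value_Icc (by norm_num) hcont
    ⟨by simpa [Real.sqrt_sq_eq_abs] using hd, hone⟩
  exact ⟨r, hr.1, h⟩

theorem exists_pair_of_product {d : ℝ} (w : ℂ) : ∃ p q : ℂ, p * q = w ∧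
    ‖p‖ ^ 2 - ‖q‖ ^ 2 = d ∧ ‖p‖ ^ 2 + ‖q‖ ^ 2 = √(d ^ 2 + 4 * ‖w‖ ^ 2) := by
  set P := √(d ^ 2 + 4 * ‖w‖ ^ 2)
  have hP : P ^ 2 = d ^ 2 + 4 * ‖w‖ ^ 2 := Real.sq_sqrt (by positivity)
  have hd : |d| ≤ P := abs_le_of_sq_le_sq (by rw [hP]; nlinarith [sq_nonneg ‖w‖])
    (Real.sqrt_nonneg _)
  have ha : 0 ≤ (P + d) / 2 := by linarith [neg_le_of_abs_le hd]
  have hb : 0 ≤ (P - d) / 2 := by linarith [le_of_abs_le hd]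
  have hab : √((P + d) / 2) * √((P - d) / 2) = ‖w‖ := by
    rw [← Real.sqrt_mul ha, ← Real.sqrt_sq (norm_nonneg w)]
    congr 1
    linarith
  obtain ⟨s, hs⟩ := exists_circle_mul_eq (p := (‖w‖ : ℂ)) (q := w) (by simp)
  -- Sum `P` and difference `d` dictate the two squared norms; the whole phase of `w` is put on the
  -- first factor.
  refine ⟨s * √((P + d) / 2), √((P - d) / 2), ?_, ?_, ?_⟩
  · rw [mul_assoc, ← Complex.ofReal_mul, hab, ← hs]
  · simp only [norm_mul, Circle.norm_coe, one_mul, Complex.norm_real, Real.norm_eq_abs, sq_abs,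
      Real.sq_sqrt ha, Real.sq_sqrt hb]
    ring
  · simp only [norm_mul, Circle.norm_coe, one_mul, Complex.norm_real, Real.norm_eq_abs, sq_abs,
      Real.sq_sqrt ha, Real.sq_sqrt hb]
    ring

theorem exists_moment_eq_oppositeProduct_eq {d : Fin 3 → ℝ} (hd : ∑ i, |d i| ≤ 1)
    (v : ComplexUnitSphere 2) :
    ∃ (z : ComplexUnitSphere 5) (r : ℂ), moment z.1 = d ∧
      ∀ i, oppositeProduct z.1 i = r * v.1 i := by
  obtain ⟨r, hr0, hr⟩ := exists_sum_sqrt_eq_one hd v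
  choose p q hpq hsub hadd using fun i => exists_pair_of_product (d := d i) (r * v.1 i)
  obtain ⟨z, hz⟩ := exists_vertex_antipode p q
  have hz1 : ∑ k, ‖z k‖ ^ 2 = 1 := by
    rw [sum_eq_sum_vertex_add_antipode, ← hr]
    refine Finset.sum_congr rfl fun i _ => ?_
    rw [(hz i).1, (hz i).2, hadd, norm_mul, Complex.norm_real, Real.norm_of_nonneg hr0]
  refine ⟨⟨z, hz1⟩, r, ?_, fun i => ?_⟩
  · funext i
    simp only [moment, (hz i).1, (hz i).2, hsub]
  · simp only [oppositeProduct, (hz i).1, (hz i).2, hpq]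

theorem symmetricPowerOrbit_eq_iff {z z' : ComplexUnitSphere 5} :
    Quotient.mk symmetricPowerOrbitRel z.toProj = Quotient.mk symmetricPowerOrbitRel z'.toProj ↔
      ∃ (t : CompactTorus 4) (a : ℂ), ∀ k, a * z.1 k = secondSymmetricPower t k * z'.1 k := by
  refine Quotient.eq.trans (exists_congr fun t => ?_)
  have hz : (secondSymmetricPower t) • z'.1 ≠ 0 := (smul_ne_zero_iff_ne _).2 z'.ne_zero
  change Projectivization.mk ℂ ((secondSymmetricPower t) • z'.1) hz =
    Projectivization.mk ℂ z.1 z.ne_zero ↔ _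
  rw [Projectivization.mk_eq_mk_iff']
  exact exists_congr fun a => funext_iff

/-- Comparing norms of unit vectors gives `‖a‖ = 1`, so the moment is unchanged, while every
opposite product is scaled by `a²` over the common weight. -/
theorem moment_eq_oppositeProduct_eq_of_orbit {z z' : ComplexUnitSphere 5} {t : CompactTorus 4}
    {a : ℂ} (h : ∀ k, a * z.1 k = secondSymmetricPower t k * z'.1 k) :
    moment z.1 = moment z'.1 ∧
      ∃ c : ℂ, ∀ i, oppositeProduct z'.1 i = c * oppositeProduct z.1 i := by
  have hn : ∀ k, ‖a‖ * ‖z.1 k‖ = ‖z'.1 k‖ := fun k => by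
    have := congrArg norm (h k)
    rwa [norm_mul, norm_mul, Circle.norm_coe, one_mul] at this
  have ha : ‖a‖ ^ 2 = 1 := by
    have h1 := z'.2
    simp only [← hn, mul_pow, ← Finset.mul_sum] at h1
    have h2 := z.2
    rwa [h2, mul_one] at h1
  refine ⟨?_, a ^ 2 * ((t 0 * t 1 * (t 2 * t 3))⁻¹ : Circle), fun i => ?_⟩
  · funext i
    simp only [moment, ← hn, mul_pow, ha, one_mul]
  · have h1 : (secondSymmetricPower t (vertex i) : ℂ) * secondSymmetricPower t (antipode i) =
        (t 0 * t 1 * (t 2 * t 3) : Circle) := by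
      rw [← Circle.coe_mul, secondSymmetricPower_vertex_mul_antipode]
    have h2 := Circle.coe_ne_zero (t 0 * t 1 * (t 2 * t 3))
    rw [Circle.coe_inv]
    field_simp
    rw [← h1]
    simp only [oppositeProduct]
    linear_combination -(secondSymmetricPower t (antipode i) * z'.1 (antipode i)) * h (vertex i) -
      a * z.1 (vertex i) * h (antipode i)

/-! ### The compact correspondence and the first homeomorphism -/

/-- The correspondence between unit vectors over `ℂP⁵` and points of `Δ_{4,2} × ℂP²`: the moment
map takes the prescribed value and the opposite products are proportional to the given vector. -/
def momentCorrespondence :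
    Set (ComplexUnitSphere 5 × hypersimplex 4 2 × ComplexUnitSphere 2) :=
  {p | moment p.1.1 = octahedralCoord p.2.1.1 ∧
    ∀ i j, oppositeProduct p.1.1 i * p.2.2.1 j = oppositeProduct p.1.1 j * p.2.2.1 i}

theorem isClosed_momentCorrespondence : IsClosed momentCorrespondence := by
  have h1 : Continuous fun p : ComplexUnitSphere 5 × hypersimplex 4 2 × ComplexUnitSphere 2 =>
      oppositeProduct p.1.1 :=
    continuous_oppositeProduct.comp (continuous_subtype_val.comp continuous_fst)
  have h2 : Continuous fun p : ComplexUnitSphere 5 × hypersimplex 4 2 × ComplexUnitSphere 2 =>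
      p.2.2.1 := continuous_subtype_val.comp (continuous_snd.comp continuous_snd)
  refine IsClosed.inter (isClosed_eq
    (continuous_moment.comp (continuous_subtype_val.comp continuous_fst))
    (continuous_octahedralCoord.comp
      (continuous_subtype_val.comp (continuous_fst.comp continuous_snd)))) ?_
  have : {p : ComplexUnitSphere 5 × hypersimplex 4 2 × ComplexUnitSphere 2 |
      ∀ i j, oppositeProduct p.1.1 i * p.2.2.1 j = oppositeProduct p.1.1 j * p.2.2.1 i} =
      ⋂ i, ⋂ j, {p | oppositeProduct p.1.1 i * p.2.2.1 j =
        oppositeProduct p.1.1 j * p.2.2.1 i} := by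
    ext p
    simp
  change IsClosed {p : ComplexUnitSphere 5 × hypersimplex 4 2 × ComplexUnitSphere 2 |
      ∀ i j, oppositeProduct p.1.1 i * p.2.2.1 j = oppositeProduct p.1.1 j * p.2.2.1 i}
  rw [this]
  exact isClosed_iInter fun i => isClosed_iInter fun j => isClosed_eq
    (((continuous_apply i).comp h1).mul ((continuous_apply j).comp h2))
    (((continuous_apply j).comp h1).mul ((continuous_apply i).comp h2))

instance : CompactSpace momentCorrespondence :=
  isCompact_iff_compactSpace.1 isClosed_momentCorrespondence.isCompact

theorem exists_eq_mul_of_mul_comm {n : ℕ} {w : Fin (n + 1) → ℂ} {v : ComplexUnitSphere n}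
    (h : ∀ i j, w i * v.1 j = w j * v.1 i) : ∃ r, ∀ i, w i = r * v.1 i := by
  obtain ⟨k, hk⟩ := Function.ne_iff.1 v.ne_zero
  replace hk : v.1 k ≠ 0 := hk
  refine ⟨w k / v.1 k, fun i => ?_⟩
  field_simp
  exact h i k

theorem momentCorrespondence_fst_surjective :
    Function.Surjective fun p : momentCorrespondence => p.1.1 := by
  intro z
  have hd : octahedralCoord (ofOctahedralCoord (moment z.1)) = moment z.1 :=
    octahedralCoord_ofOctahedralCoord _
  have hx := ofOctahedralCoord_mem (sum_abs_moment_le_one z)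
  by_cases hw : oppositeProduct z.1 = 0
  -- When all products vanish, every line is compatible; the one through `(1, 1, 1)` is an arbitrary
  -- choice.
  · refine ⟨⟨(z, ⟨_, hx⟩, ComplexUnitSphere.normalize ⟨1, one_ne_zero⟩), hd.symm, ?_⟩, rfl⟩
    simp [hw]
  · refine ⟨⟨(z, ⟨_, hx⟩, ComplexUnitSphere.normalize ⟨_, hw⟩), hd.symm, fun i j => ?_⟩, rfl⟩
    simp only [ComplexUnitSphere.normalize, Pi.smul_apply, Complex.real_smul]
    ring

theorem momentCorrespondence_snd_surjective :
    Function.Surjective fun p : momentCorrespondence => p.1.2 := by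
  rintro ⟨x, v⟩
  obtain ⟨z, r, hz, hr⟩ :=
    exists_moment_eq_oppositeProduct_eq (mem_hypersimplex_four_two_iff.1 x.2).2 v
  refine ⟨⟨(z, x, v), hz, fun i j => ?_⟩, rfl⟩
  simp only [hr]
  ring

theorem momentCorrespondence_fibres (p q : momentCorrespondence) :
    Quotient.mk symmetricPowerOrbitRel p.1.1.toProj =
        Quotient.mk symmetricPowerOrbitRel q.1.1.toProj ↔
      Quotient.mk (boundaryGluing (hypersimplex 4 2) (ComplexProjectiveSpace 2))
          (p.1.2.1, p.1.2.2.toProj) =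
        Quotient.mk (boundaryGluing (hypersimplex 4 2) (ComplexProjectiveSpace 2))
          (q.1.2.1, q.1.2.2.toProj) := by
  obtain ⟨⟨z, x, v⟩, hm, hv⟩ := p
  obtain ⟨⟨z', x', v'⟩, hm', hv'⟩ := q
  dsimp only at hm hv hm' hv' ⊢
  obtain ⟨r, hr⟩ := exists_eq_mul_of_mul_comm hv
  obtain ⟨r', hr'⟩ := exists_eq_mul_of_mul_comm hv'
  have hfr : ∀ {y : hypersimplex 4 2} {u : ComplexUnitSphere 5},
      moment u.1 = octahedralCoord y.1 →
      (y.1 ∈ intrinsicFrontier ℝ (hypersimplex 4 2) ↔ oppositeProduct u.1 = 0) := by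
    intro y u h
    rw [mem_intrinsicFrontier_hypersimplex_iff y.2, ← h, sum_abs_moment_eq_one_iff]
  rw [symmetricPowerOrbit_eq_iff, Quotient.eq]
  constructor
  · rintro ⟨t, a, h⟩
    obtain ⟨hmm, c, hc⟩ := moment_eq_oppositeProduct_eq_of_orbit h
    have hx : x = x' := Subtype.ext (octahedralCoord_injOn x.2 x'.2 (by rw [← hm, ← hm', hmm]))
    by_cases hw : oppositeProduct z'.1 = 0
    · exact Or.inr ⟨hx, hx ▸ (hfr hm').2 hw⟩
    -- Off the boundary the product vectors are nonzero and proportional, hence so are the vectors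
    -- `v` and `v'` spanning their lines.
    · refine Or.inl (Prod.ext hx (ComplexUnitSphere.toProj_eq_iff.2 ?_))
      obtain ⟨i, hi⟩ := Function.ne_iff.1 hw
      have hcr : c * r ≠ 0 := by
        rintro h0
        refine hi ?_
        rw [hc, hr, ← mul_assoc, h0, zero_mul]
        rfl
      refine ⟨(c * r)⁻¹ * r', fun j => ?_⟩
      rw [mul_assoc, ← hr', hc, hr, ← mul_assoc c, inv_mul_cancel_left₀ hcr]
  · intro h
    have hx : x = x' := by
      rcases h with h | ⟨h, _⟩
      · exact congrArg Prod.fst h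
      · exact h
    have hmm : moment z'.1 = moment z.1 := by rw [hm, hm', hx]
    -- It is enough that the products of `z` also lie on the line of `v'`: either the two lines
    -- coincide, or the products vanish on the boundary and `s = 0` works.
    suffices ∃ s, ∀ i, oppositeProduct z.1 i = s * v'.1 i by
      obtain ⟨s, hs⟩ := this
      obtain ⟨t, ht⟩ := exists_torus_of_moment_eq v'.ne_zero hmm hr' hs
      exact ⟨t, 1, fun k => by rw [one_mul, ht]⟩
    rcases h with h | ⟨_, h⟩
    · obtain ⟨c, hc⟩ := ComplexUnitSphere.toProj_eq_iff.1 (congrArg Prod.snd h)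
      exact ⟨r * c, fun i => by rw [hr, hc, mul_assoc]⟩
    · exact ⟨0, fun i => by rw [(hfr hm).1 h, zero_mul, Pi.zero_apply]⟩

/-- Both projections of the correspondence are continuous surjections from a compact space to a
Hausdorff one, hence quotient maps. -/
theorem nonempty_symmetricPowerOrbitSpace_homeomorph_gluing :
    Nonempty (SymmetricPowerOrbitSpace ≃ₜ
      Quotient (boundaryGluing (hypersimplex 4 2) (ComplexProjectiveSpace 2))) := by
  have h1 : IsQuotientMap fun p : momentCorrespondence => p.1.1 :=
    IsQuotientMap.of_surjective_continuous momentCorrespondence_fst_surjective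
      (continuous_fst.comp continuous_subtype_val)
  have h2 : IsQuotientMap fun p : momentCorrespondence => p.1.2 :=
    IsQuotientMap.of_surjective_continuous momentCorrespondence_snd_surjective
      (continuous_snd.comp continuous_subtype_val)
  exact ((isQuotientMap_quotient_mk' (s := symmetricPowerOrbitRel)).comp
    (ComplexUnitSphere.isQuotientMap_toProj.comp h1)).nonempty_homeomorph
    ((isQuotientMap_quotient_mk' (s := boundaryGluing (hypersimplex 4 2)
      (ComplexProjectiveSpace 2))).comp
      ((ComplexUnitSphere.isQuotientMap_prodMap_toProj _).comp h2)) momentCorrespondence_fibres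

/-! ### The octahedron as a cone, and the join -/

/-- Polar coordinates on the octahedron, with the boundary at `t = 0` and the centre at `t = 1`. -/
noncomputable def octahedralPolar
    (p : Metric.sphere (0 : EuclideanSpace ℝ (Fin 3)) 1 × unitInterval) (i : Fin 3) : ℝ :=
  (1 - p.2) * (p.1.1 i / ∑ j, |p.1.1 j|)

theorem sum_abs_pos_of_mem_sphere (u : Metric.sphere (0 : EuclideanSpace ℝ (Fin 3)) 1) :
    0 < ∑ j, |u.1 j| := by
  have hu : u.1 ≠ 0 := ne_zero_of_mem_unit_sphere u
  have : ∃ j, u.1 j ≠ 0 := by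
    by_contra! h
    exact hu (by ext j; exact h j)
  obtain ⟨j, hj⟩ := this
  exact Finset.sum_pos' (fun _ _ => abs_nonneg _) ⟨j, Finset.mem_univ j, abs_pos.2 hj⟩

theorem sum_abs_octahedralPolar
    (p : Metric.sphere (0 : EuclideanSpace ℝ (Fin 3)) 1 × unitInterval) :
    ∑ i, |octahedralPolar p i| = 1 - p.2 := by
  have h := sum_abs_pos_of_mem_sphere p.1
  simp only [octahedralPolar, abs_mul, abs_div, ← Finset.mul_sum, ← Finset.sum_div,
    abs_of_pos h, div_self h.ne', mul_one]
  exact abs_of_nonneg (sub_nonneg.2 p.2.2.2)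

theorem continuous_octahedralPolar : Continuous octahedralPolar := by
  have h : ∀ i, Continuous fun p : Metric.sphere (0 : EuclideanSpace ℝ (Fin 3)) 1 × unitInterval =>
      p.1.1 i := fun i => by fun_prop
  refine continuous_pi fun i => Continuous.mul (by fun_prop) ((h i).div
    (continuous_finsetSum _ fun j _ => (h j).abs) fun p => (sum_abs_pos_of_mem_sphere p.1).ne')

/-- The `ℓ¹` norm recovers `1 - t`. Away from the centre the directions are then positive multiples
of each other, hence equal as Euclidean unit vectors. -/
theorem octahedralPolar_eq_iff
    {p q : Metric.sphere (0 : EuclideanSpace ℝ (Fin 3)) 1 × unitInterval} :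
    octahedralPolar p = octahedralPolar q ↔ p.2 = q.2 ∧ (p.2 = 1 ∨ p.1 = q.1) := by
  constructor
  · intro h
    have ht : p.2 = q.2 := by
      have := sum_abs_octahedralPolar p
      rw [h, sum_abs_octahedralPolar] at this
      exact Subtype.ext (by linarith)
    refine ⟨ht, or_iff_not_imp_left.2 fun h1 => Subtype.ext ?_⟩
    have h1' : (1 - p.2 : ℝ) ≠ 0 := fun h0 => h1 (Subtype.ext
      (sub_eq_zero.1 h0).symm)
    have hp := sum_abs_pos_of_mem_sphere p.1
    have hq := sum_abs_pos_of_mem_sphere q.1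
    set P := ∑ j, |p.1.1 j|
    set Q := ∑ j, |q.1.1 j|
    have hi : p.1.1 = (P / Q) • q.1.1 := by
      ext i
      have h2 := congrFun h i
      simp only [octahedralPolar, ← ht] at h2
      have h3 := mul_left_cancel₀ h1' h2
      rw [PiLp.smul_apply, smul_eq_mul]
      change p.1.1 i / P = q.1.1 i / Q at h3
      field_simp at h3 ⊢
      linarith
    have hn : P / Q = 1 := by
      have h4 := congrArg norm hi
      rwa [norm_smul, norm_eq_of_mem_sphere, norm_eq_of_mem_sphere, mul_one,
        Real.norm_of_nonneg (by positivity), eq_comm] at h4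
    rw [hi, hn, one_smul]
  · rintro ⟨ht, h1 | hu⟩
    · funext i
      simp [octahedralPolar, ← ht, h1]
    · rw [Prod.ext hu ht]

theorem exists_octahedralPolar_eq {d : Fin 3 → ℝ} (hd : ∑ i, |d i| ≤ 1) :
    ∃ p, octahedralPolar p = d := by
  by_cases h0 : d = 0
  -- At the centre `t = 1` and the direction is arbitrary.
  · refine ⟨(⟨EuclideanSpace.single 0 1, by simp⟩, 1), ?_⟩
    funext i
    simp [octahedralPolar, h0]
  · have he : WithLp.toLp 2 d ≠ 0 := fun h => h0 (by simpa using h)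
    have hn : 0 < ‖WithLp.toLp 2 d‖ := norm_pos_iff.2 he
    have hs : 0 < ∑ i, |d i| := by
      obtain ⟨i, hi⟩ := Function.ne_iff.1 h0
      exact Finset.sum_pos' (fun _ _ => abs_nonneg _) ⟨i, Finset.mem_univ i, abs_pos.2 hi⟩
    refine ⟨(⟨‖WithLp.toLp 2 d‖⁻¹ • WithLp.toLp 2 d, ?_⟩,
      ⟨1 - ∑ i, |d i|, sub_nonneg.2 hd, sub_le_self _ hs.le⟩), ?_⟩
    · rw [mem_sphere_zero_iff_norm, norm_smul, norm_inv, norm_norm, inv_mul_cancel₀ hn.ne']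
    · funext i
      simp only [octahedralPolar, PiLp.smul_apply, smul_eq_mul, abs_mul, abs_inv, abs_norm,
        ← Finset.mul_sum]
      field_simp
      ring

/-- `octahedralPolar` as a map to the hypersimplex. -/
noncomputable def hypersimplexPolar
    (p : Metric.sphere (0 : EuclideanSpace ℝ (Fin 3)) 1 × unitInterval) : hypersimplex 4 2 :=
  ⟨ofOctahedralCoord (octahedralPolar p), ofOctahedralCoord_mem (by
    rw [sum_abs_octahedralPolar]
    exact sub_le_self _ p.2.2.1)⟩

theorem continuous_hypersimplexPolar : Continuous hypersimplexPolar :=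
  (continuous_ofOctahedralCoord.comp continuous_octahedralPolar).subtype_mk _

theorem octahedralCoord_hypersimplexPolar
    (p : Metric.sphere (0 : EuclideanSpace ℝ (Fin 3)) 1 × unitInterval) :
    octahedralCoord (hypersimplexPolar p).1 = octahedralPolar p :=
  octahedralCoord_ofOctahedralCoord _

theorem hypersimplexPolar_surjective : Function.Surjective hypersimplexPolar := by
  intro x
  obtain ⟨p, hp⟩ := exists_octahedralPolar_eq (mem_hypersimplex_four_two_iff.1 x.2).2
  exact ⟨p, Subtype.ext (octahedralCoord_injOn (Subtype.prop _) x.2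
    (by rw [octahedralCoord_hypersimplexPolar, hp]))⟩

theorem hypersimplexPolar_eq_iff
    {p q : Metric.sphere (0 : EuclideanSpace ℝ (Fin 3)) 1 × unitInterval} :
    hypersimplexPolar p = hypersimplexPolar q ↔ p.2 = q.2 ∧ (p.2 = 1 ∨ p.1 = q.1) := by
  rw [← octahedralPolar_eq_iff, ← octahedralCoord_hypersimplexPolar,
    ← octahedralCoord_hypersimplexPolar, Subtype.ext_iff]
  exact (octahedralCoord_injOn.eq_iff (Subtype.prop _) (Subtype.prop _)).symm

theorem hypersimplexPolar_mem_intrinsicFrontier_iff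
    {p : Metric.sphere (0 : EuclideanSpace ℝ (Fin 3)) 1 × unitInterval} :
    (hypersimplexPolar p).1 ∈ intrinsicFrontier ℝ (hypersimplex 4 2) ↔ p.2 = 0 := by
  rw [mem_intrinsicFrontier_hypersimplex_iff (Subtype.prop _), octahedralCoord_hypersimplexPolar,
    sum_abs_octahedralPolar, sub_eq_self, Set.Icc.coe_eq_zero]

theorem nonempty_join_homeomorph_gluing (Y : Type*) [TopologicalSpace Y] :
    Nonempty (TopologicalJoin (Metric.sphere (0 : EuclideanSpace ℝ (Fin 3)) 1) Y ≃ₜ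
      Quotient (boundaryGluing (hypersimplex 4 2) Y)) := by
  let e : Metric.sphere (0 : EuclideanSpace ℝ (Fin 3)) 1 × Y × unitInterval ≃ₜ
      (Metric.sphere (0 : EuclideanSpace ℝ (Fin 3)) 1 × unitInterval) × Y :=
    ((Homeomorph.refl _).prodCongr (Homeomorph.prodComm _ _)).trans
      (Homeomorph.prodAssoc _ _ _).symm
  have h1 : IsQuotientMap (Prod.map hypersimplexPolar (id : Y → Y)) := by
    -- The polar map is proper, its source being compact, so its product with the identity of `Y`
    -- stays closed for an arbitrary space `Y`.
    have hp := continuous_hypersimplexPolar.isProperMap.prodMap (isProperMap_id (X := Y))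
    exact hp.isClosedMap.isQuotientMap hp.continuous
      (hypersimplexPolar_surjective.prodMap Function.surjective_id)
  refine (isQuotientMap_quotient_mk' (s := joinSetoid _ Y)).nonempty_homeomorph
    ((isQuotientMap_quotient_mk' (s := boundaryGluing (hypersimplex 4 2) Y)).comp
      (h1.comp e.isQuotientMap)) ?_
  rintro ⟨u, y, t⟩ ⟨u', y', t'⟩
  refine Quotient.eq.trans (Iff.trans ?_ Quotient.eq.symm)
  change (_ ∨ _ ∨ _) ↔ ((hypersimplexPolar (u, t), y) = (hypersimplexPolar (u', t'), y') ∨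
    (hypersimplexPolar (u, t) = hypersimplexPolar (u', t') ∧
      (hypersimplexPolar (u, t)).1 ∈ intrinsicFrontier ℝ (hypersimplex 4 2)))
  rw [hypersimplexPolar_mem_intrinsicFrontier_iff, Prod.mk.injEq]
  simp only [hypersimplexPolar_eq_iff, Prod.mk.injEq]
  have h01 : (0 : unitInterval) ≠ 1 := zero_ne_one
  constructor
  · rintro (⟨rfl, rfl, rfl⟩ | ⟨rfl, rfl, rfl⟩ | ⟨rfl, rfl, rfl⟩) <;> simp
  · rintro (⟨⟨rfl, rfl | rfl⟩, rfl⟩ | ⟨⟨rfl, rfl | rfl⟩, h⟩)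
    · simp
    · simp
    · exact absurd h h01.symm
    · simp [h]

theorem mainTheorem4 :
    Nonempty (SymmetricPowerOrbitSpace ≃ₜ
      Quotient (boundaryGluing (hypersimplex 4 2) (ComplexProjectiveSpace 2))) ∧
    Nonempty (SymmetricPowerOrbitSpace ≃ₜ
      TopologicalJoin (Metric.sphere (0 : EuclideanSpace ℝ (Fin 3)) 1)
        (ComplexProjectiveSpace 2)) := by
  obtain ⟨f⟩ := nonempty_symmetricPowerOrbitSpace_homeomorph_gluing
  obtain ⟨g⟩ := nonempty_join_homeomorph_gluing (ComplexProjectiveSpace 2)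
  exact ⟨⟨f⟩, ⟨f.trans g.symm⟩⟩
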